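/- Throughout, $\log$ is the natural logarithm and $|u|^{+}=\max\{0,u\}$. Let $\mathcal X$ be a countably infinite discrete alphabet, identified with $\mathbb N$. For a probability mass function $P$ on $\mathcal X$ let $H(P)=\sum_x P(x)\log\frac1{P(x)}\in[0,\infty]$ be its Shannon entropy, $P^{\downarrow}$ its decreasing rearrangement and, for $\alpha>1$, $\|P\|_\alpha=(\sum_x P(x)^\alpha)^{1/\alpha}$; $Q$ majorizes $P$ if $\sum_{i=1}^k P^{\downarrow}(i)\le\sum_{i=1}^k Q^{\downarrow}(i)$ for every $k\ge1$. For an $\mathcal X$-valued random variable $X$ with distribution $P_X$ write $H(X)=H(P_X)$. For a random variable $Y$ on the same probability space with values in a measurable space $\mathcal Y$, let $P_{X|Y}$ be the regular conditional distribution of $X$ given $Y$ and put $$H_1^{\mathrm A}(X|Y)=H_1^{\mathrm H}(X|Y)=H(X|Y)=\mathbb E[H(P_{X|Y})],$$ $$H_\alpha^{\mathrm A}(X|Y)=\frac{\alpha}{1-\alpha}\log\mathbb E[\|P_{X|Y}\|_\alpha],\qquad H_\alpha^{\mathrm H}(X|Y)=\frac{1}{1-\alpha}\log\mathbb E[\|P_{X|Y}\|_\alpha^\alpha]\qquad(1<\alpha<\infty)$$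 (the conditional Rényi entropies of Arimoto and of Hayashi). For an integer $L\ge1$ let $P_{\mathrm e}^{(L)}(X|Y)=\inf_f\mathbb P\{X\notin f(Y)\}$, the infimum being over all measurable maps $f$ that assign to each $y\in\mathcal Y$ a nonempty set of at most $L$ elements of $\mathcal X$. **Theorem.** Let $X$ be an $\mathcal X$-valued random variable with $H(X)<\infty$, let $(L_n)$ be a sequence of positive integers, and let $(X_n,Y_n)$ be a sequence of pairs of random variables, $X_n$ with values in $\mathcal X$ and $Y_n$ with values in a measurable space $\mathcal Y_n$. Let $1\le\alpha<\infty$, and suppose that at least one of the following conditions holds: (a) $\alpha>1$; (b) $(X_n)$ satisfies the asymptotic equipartition property, i.e. $\lim_{n\to\infty}\mathbb P\{\log\frac1{P_{X_n}(X_n)}\le(1-\delta)H(X_n)\}=0$ for every $\delta>0$, and $H(X_n)=O(1)$; (c) there is an $n_0$ such that $P_{X_n}$ majorizes $P_X$ for every $n\ge n_0$; (d) $X_n\to X$ in distribution and $H(X_n)\to H(X)$ as $n\to\infty$. Then, for each $\dagger\in\{\mathrm A,\mathrm H\}$, if $P_{\mathrm e}^{(L_n)}(X_n|Y_n)\to0$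 as $n\to\infty$, then $|H_\alpha^{\dagger}(X_n|Y_n)-\log L_n|^{+}\to0$ as $n\to\infty$. -/

import Mathlib

open MeasureTheory ProbabilityTheory Filter Topology
open scoped ENNReal NNReal

noncomputable section

namespace FanoList

/-- The probability mass function `P_X` of a random variable `X` with values in the countably
infinite alphabet `ℕ`. -/
def law {Ω : Type*} [MeasurableSpace Ω] (μ : Measure Ω) (X : Ω → ℕ) : ℕ → ℝ≥0∞ :=
  fun x => μ (X ⁻¹' {x})

/-- The conditional mass function `P_{X|Y}(· | Y = y)`, through the regular conditional
distribution of `X` given `Y`. -/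
def condLaw {Ω 𝓨 : Type*} [MeasurableSpace Ω] [MeasurableSpace 𝓨] (μ : Measure Ω)
    [IsProbabilityMeasure μ] (X : Ω → ℕ) (Y : Ω → 𝓨) (y : 𝓨) : ℕ → ℝ≥0∞ :=
  fun x => condDistrib X Y μ y {x}

/-- The decreasing rearrangement `p↓`, indexed from `0`: `p↓ i` is the least level `t` that is
exceeded by at most `i` of the values of `p`, i.e. the `(i+1)`-st largest value of `p`. -/
def decRearr (p : ℕ → ℝ≥0∞) (i : ℕ) : ℝ≥0∞ :=
  sInf {t : ℝ≥0∞ | {x : ℕ | t < p x}.encard ≤ (i : ℕ∞)}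

/-- `q` majorizes `p`: every partial sum of `p↓` is at most the corresponding one of `q↓`. -/
def Majorizes (q p : ℕ → ℝ≥0∞) : Prop :=
  ∀ k : ℕ, ∑ i ∈ Finset.range k, decRearr p i ≤ ∑ i ∈ Finset.range k, decRearr q i

/-- The Shannon entropy `∑ p(x) log (1 / p(x))` (natural logarithm, `0 log (1 / 0) = 0`) of a
probability mass function, with values in `[0, ∞]`. -/
def shannonEntropy (p : ℕ → ℝ≥0∞) : ℝ≥0∞ :=
  ∑' x, ENNReal.ofReal (Real.negMulLog (p x).toReal)

/-- The norm `‖p‖_α = (∑ p(x)^α)^(1/α)`. -/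
def alphaNorm (α : ℝ) (p : ℕ → ℝ≥0∞) : ℝ≥0∞ :=
  (∑' x, p x ^ α) ^ (1 / α)

section Conditional

variable {Ω 𝓨 : Type*} [MeasurableSpace Ω] [MeasurableSpace 𝓨]

/-- The conditional Shannon entropy `H(X|Y) = E[H(P_{X|Y})]`. -/
def condShannonEntropy (μ : Measure Ω) [IsProbabilityMeasure μ] (X : Ω → ℕ) (Y : Ω → 𝓨) :
    ℝ≥0∞ :=
  ∫⁻ ω, shannonEntropy (condLaw μ X Y (Y ω)) ∂μ

/-- Arimoto's conditional Rényi entropy `α / (1 - α) * log E[‖P_{X|Y}‖_α]`; for `α = 1` it is by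
convention the conditional Shannon entropy. -/
def arimotoEntropy (α : ℝ) (μ : Measure Ω) [IsProbabilityMeasure μ] (X : Ω → ℕ) (Y : Ω → 𝓨) :
    EReal :=
  if α = 1 then (condShannonEntropy μ X Y : EReal)
  else ((α / (1 - α) : ℝ) : EReal) *
    ENNReal.log (∫⁻ ω, alphaNorm α (condLaw μ X Y (Y ω)) ∂μ)

/-- Hayashi's conditional Rényi entropy `1 / (1 - α) * log E[‖P_{X|Y}‖_α ^ α]`; for `α = 1` it is
by convention the conditional Shannon entropy. -/
def hayashiEntropy (α : ℝ) (μ : Measure Ω) [IsProbabilityMeasure μ] (X : Ω → ℕ) (Y : Ω → 𝓨) :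
    EReal :=
  if α = 1 then (condShannonEntropy μ X Y : EReal)
  else ((1 / (1 - α) : ℝ) : EReal) *
    ENNReal.log (∫⁻ ω, alphaNorm α (condLaw μ X Y (Y ω)) ^ α ∂μ)

/-- A list decoder with list size `L`: a measurable map from `𝓨` to the nonempty sets of at most
`L` letters (the countable set of all finite sets of letters carries the discrete σ-algebra). -/
def IsListDecoder (L : ℕ) (f : 𝓨 → Finset ℕ) : Prop :=
  (∀ y, 1 ≤ (f y).card ∧ (f y).card ≤ L) ∧ ∀ D : Finset ℕ, MeasurableSet (f ⁻¹' {D})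

/-- The minimum average error probability `P_e^{(L)}(X|Y)` under list decoding with list
size `L`. -/
def listError (L : ℕ) (μ : Measure Ω) (X : Ω → ℕ) (Y : Ω → 𝓨) : ℝ≥0∞ :=
  ⨅ (f : 𝓨 → Finset ℕ) (_ : IsListDecoder L f), μ {ω | X ω ∉ f (Y ω)}

end Conditional

/-- The asymptotic equipartition property of a general source: for every `δ > 0`,
`P{log (1 / P_{X_n}(X_n)) ≤ (1 - δ) H(X_n)} → 0`. -/
def AEP {Ω : ℕ → Type*} [∀ n, MeasurableSpace (Ω n)] (μ : ∀ n, Measure (Ω n))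
    (X : ∀ n, Ω n → ℕ) : Prop :=
  ∀ δ : ℝ, 0 < δ →
    Tendsto (fun n => μ n {ω | ENNReal.log (law (μ n) (X n) (X n ω))⁻¹ ≤
      ((1 - δ : ℝ) : EReal) * (shannonEntropy (law (μ n) (X n)) : EReal)}) atTop (𝓝 0)

end FanoList

end

noncomputable section

namespace FanoList

/-! For α = 1 the heart is Fano's inequality for lists. By Gibbs' inequality, `H(P_{X|Y=y})` is at
most the mean code length of any sub-probability. Take one that puts mass `e^{-η}` uniformly on a
list of size `L` and mass `1 - e^{-η}` according to `P_X` off it. Averaging over `Y` bounds `H(X|Y)`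
by `log L + η`, plus a constant times the error probability, plus the integral of the surprisal `log
(1 / P_X(X))` over the error event (`condShannonEntropy_le`). The last term vanishes with the error
probability once the surprisals are uniformly integrable, and each of (b), (c), (d) gives this.
Under (b), almost all of the entropy already sits on the complement of a rare event. Under (c), the
excess surprisal is dominated by an integral of the truncated sums `∑ min(p(x), t)`, which
majorization controls. Under (d), convergence of the entropies forces small entropy tails.

For α > 1, the power mean inequality on the list bounds the conditional success probability by
`L^{(α-1)/α} ‖P_{X|Y}‖_α`. Integrating this, or its α-th power together with Jensen's inequality,
gives both Rényi bounds. -/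

/-- The surprisal `log (1 / q)`, with values in `[0, ∞]`. -/
def surprisal (q : ℝ≥0∞) : ℝ≥0∞ := (ENNReal.log q⁻¹).toENNReal

/-! ### Surprisal and Gibbs' inequality -/

lemma surprisal_zero : surprisal 0 = ∞ := by simp [surprisal]

lemma surprisal_ofReal {q : ℝ} (hq : 0 < q) :
    surprisal (ENNReal.ofReal q) = ENNReal.ofReal (-Real.log q) := by
  rw [surprisal, ENNReal.log_inv, ENNReal.log_ofReal_of_pos hq, ← EReal.coe_neg,
    EReal.real_coe_toENNReal]

lemma surprisal_mul_le (a b : ℝ≥0∞) (ha : a ≤ 1) (hb : b ≤ 1) :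
    surprisal (a * b) ≤ surprisal a + surprisal b := by
  rcases eq_or_ne a 0 with rfl | ha0
  · simp [surprisal_zero]
  rcases eq_or_ne b 0 with rfl | hb0
  · simp [surprisal_zero]
  have ha' : a ≠ ∞ := ne_top_of_le_ne_top ENNReal.one_ne_top ha
  have hb' : b ≠ ∞ := ne_top_of_le_ne_top ENNReal.one_ne_top hb
  lift a to ℝ≥0 using ha'
  lift b to ℝ≥0 using hb'
  have hap : (0 : ℝ) < a := by simpa [pos_iff_ne_zero] using ha0
  have hbp : (0 : ℝ) < b := by simpa [pos_iff_ne_zero] using hb0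
  rw [← ENNReal.coe_mul, ← ENNReal.ofReal_coe_nnreal, ← ENNReal.ofReal_coe_nnreal (p := a),
    ← ENNReal.ofReal_coe_nnreal (p := b), NNReal.coe_mul, surprisal_ofReal (by positivity),
    surprisal_ofReal hap, surprisal_ofReal hbp, Real.log_mul hap.ne' hbp.ne', neg_add]
  exact ENNReal.ofReal_add_le

lemma ofReal_negMulLog_eq {p : ℝ≥0∞} (hp : p ≤ 1) :
    ENNReal.ofReal (Real.negMulLog p.toReal) = p * surprisal p := by
  rcases eq_or_ne p 0 with rfl | hp0
  · simp
  have hp' : p ≠ ∞ := ne_top_of_le_ne_top ENNReal.one_ne_top hp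
  have hpos := ENNReal.toReal_pos hp0 hp'
  conv_rhs => rw [← ENNReal.ofReal_toReal hp', surprisal_ofReal hpos,
    ← ENNReal.ofReal_mul hpos.le]
  congr 1
  simp [Real.negMulLog]

/-- Pointwise Gibbs inequality: `log t ≤ t - 1` at `t = q / p`, multiplied by `p` and rearranged so
that no subtraction occurs in `[0, ∞]`. -/
lemma ofReal_negMulLog_add_le {p q : ℝ≥0∞} (hp : p ≤ 1) (hq : q ≤ 1) :
    ENNReal.ofReal (Real.negMulLog p.toReal) + p ≤ p * surprisal q + q := by
  rcases eq_or_ne p 0 with rfl | hp0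
  · simp
  rcases eq_or_ne q 0 with rfl | hq0
  · simp [surprisal_zero, ENNReal.mul_top hp0]
  have hp' : p ≠ ∞ := ne_top_of_le_ne_top ENNReal.one_ne_top hp
  have hq' : q ≠ ∞ := ne_top_of_le_ne_top ENNReal.one_ne_top hq
  have hppos := ENNReal.toReal_pos hp0 hp'
  have hqpos := ENNReal.toReal_pos hq0 hq'
  have hp1 : p.toReal ≤ 1 := ENNReal.toReal_le_of_le_ofReal zero_le_one (by simpa using hp)
  have hq1 : q.toReal ≤ 1 := ENNReal.toReal_le_of_le_ofReal zero_le_one (by simpa using hq)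
  set a := p.toReal with ha
  set b := q.toReal with hb
  have hpa : p = ENNReal.ofReal a := (ENNReal.ofReal_toReal hp').symm
  have hqb : q = ENNReal.ofReal b := (ENNReal.ofReal_toReal hq').symm
  rw [hpa, hqb, surprisal_ofReal hqpos, ← ENNReal.ofReal_mul hppos.le,
    ← ENNReal.ofReal_add (Real.negMulLog_nonneg hppos.le hp1) hppos.le,
    ← ENNReal.ofReal_add _ hqpos.le]
  · apply ENNReal.ofReal_le_ofReal
    have h := Real.log_le_sub_one_of_pos (div_pos hqpos hppos)
    rw [Real.log_div hqpos.ne' hppos.ne'] at h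
    have h2 := mul_le_mul_of_nonneg_left h hppos.le
    have h3 : a * (b / a - 1) = b - a := by field_simp
    rw [h3] at h2
    simp only [Real.negMulLog]
    nlinarith
  · have := Real.log_nonpos hqpos.le hq1
    exact mul_nonneg hppos.le (by linarith)

/-- Gibbs' inequality. -/
lemma shannonEntropy_le_tsum {p q : ℕ → ℝ≥0∞} (hp : ∑' x, p x = 1) (hq : ∑' x, q x ≤ 1) :
    shannonEntropy p ≤ ∑' x, p x * surprisal (q x) := by
  have hp1 : ∀ x, p x ≤ 1 := fun x => hp ▸ ENNReal.le_tsum x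
  have hq1 : ∀ x, q x ≤ 1 := fun x => (ENNReal.le_tsum x).trans hq
  have h := ENNReal.tsum_le_tsum fun x => ofReal_negMulLog_add_le (hp1 x) (hq1 x)
  rw [ENNReal.tsum_add, ENNReal.tsum_add, hp] at h
  have h2 := h.trans (add_le_add_right hq _)
  exact (ENNReal.add_le_add_iff_right ENNReal.one_ne_top).1 h2

/-! ### Laws and disintegration -/

section Law

variable {Ω : Type*} [MeasurableSpace Ω]

lemma lintegral_comp_eq_tsum_law (μ : Measure Ω) {X : Ω → ℕ} (hX : Measurable X)
    (F : ℕ → ℝ≥0∞) : ∫⁻ ω, F (X ω) ∂μ = ∑' x, law μ X x * F x := by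
  rw [← lintegral_map (measurable_from_top (f := F)) hX, lintegral_countable']
  refine tsum_congr fun x => ?_
  rw [Measure.map_apply hX (measurableSet_singleton x), mul_comm, law]

lemma tsum_law (μ : Measure Ω) [IsProbabilityMeasure μ] {X : Ω → ℕ} (hX : Measurable X) :
    ∑' x, law μ X x = 1 := by
  simpa using (lintegral_comp_eq_tsum_law μ hX (fun _ => 1)).symm

lemma law_le_one (μ : Measure Ω) [IsProbabilityMeasure μ] (X : Ω → ℕ) (x : ℕ) :
    law μ X x ≤ 1 := prob_le_one

lemma shannonEntropy_law (μ : Measure Ω) [IsProbabilityMeasure μ] {X : Ω → ℕ}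
    (hX : Measurable X) :
    shannonEntropy (law μ X) = ∫⁻ ω, surprisal (law μ X (X ω)) ∂μ := by
  rw [lintegral_comp_eq_tsum_law μ hX (fun x => surprisal (law μ X x))]
  exact tsum_congr fun x => ofReal_negMulLog_eq (law_le_one μ X x)

variable {𝓨 : Type*} [MeasurableSpace 𝓨] (μ : Measure Ω) [IsProbabilityMeasure μ]

lemma tsum_condLaw (X : Ω → ℕ) (Y : Ω → 𝓨) (y : 𝓨) : ∑' x, condLaw μ X Y y x = 1 := by
  have h := lintegral_countable' (μ := condDistrib X Y μ y) (fun _ => 1)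
  simpa [condLaw] using h.symm

lemma lintegral_tsum_condLaw {X : Ω → ℕ} (hX : Measurable X) {Y : Ω → 𝓨} (hY : Measurable Y)
    {F : 𝓨 × ℕ → ℝ≥0∞} (hF : Measurable F) :
    ∫⁻ ω, ∑' x, condLaw μ X Y (Y ω) x * F (Y ω, x) ∂μ = ∫⁻ ω, F (Y ω, X ω) ∂μ := by
  rw [← lintegral_map hF (hY.prodMk hX), ← compProd_map_condDistrib hX.aemeasurable,
    Measure.lintegral_compProd hF, lintegral_map _ hY]
  · refine lintegral_congr fun ω => ?_
    rw [lintegral_countable']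
    exact tsum_congr fun x => mul_comm _ _
  · exact hF.lintegral_kernel_prod_right'

lemma measurable_condLaw (X : Ω → ℕ) (Y : Ω → 𝓨) (x : ℕ) :
    Measurable fun y => condLaw μ X Y y x :=
  Kernel.measurable_coe _ (measurableSet_singleton x)

end Law

/-! ### Fano's inequality for lists -/

section Fano

variable {Ω 𝓨 : Type*} [MeasurableSpace Ω] [MeasurableSpace 𝓨]

lemma IsListDecoder.measurableSet_mem {L : ℕ} {f : 𝓨 → Finset ℕ} (hf : IsListDecoder L f) :
    MeasurableSet {z : 𝓨 × ℕ | z.2 ∈ f z.1} := by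
  have : {z : 𝓨 × ℕ | z.2 ∈ f z.1} = ⋃ D : Finset ℕ, (f ⁻¹' {D}) ×ˢ (D : Set ℕ) := by
    ext z
    simp
  rw [this]
  exact MeasurableSet.iUnion fun D => (hf.2 D).prod D.measurableSet

/-- Admissibility in Gibbs' inequality of the code used for Fano: the list receives mass at most
`a`, and the letters off it at most `b`. -/
lemma tsum_ite_finset_le {D : Finset ℕ} {L : ℕ} (hL : 1 ≤ L) (hD : D.card ≤ L)
    {q : ℕ → ℝ≥0∞} (hq : ∑' x, q x ≤ 1) {a b : ℝ≥0∞} (hab : a + b = 1) :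
    ∑' x, (if x ∈ D then a * (L : ℝ≥0∞)⁻¹ else b * q x) ≤ 1 := by
  have hL0 : (L : ℝ≥0∞) ≠ 0 := by simp; omega
  calc ∑' x, (if x ∈ D then a * (L : ℝ≥0∞)⁻¹ else b * q x)
      ≤ ∑' x, ((if x ∈ D then a * (L : ℝ≥0∞)⁻¹ else 0) + b * q x) := by
        refine ENNReal.tsum_le_tsum fun x => ?_
        split_ifs <;> simp
    _ = D.card * (a * (L : ℝ≥0∞)⁻¹) + b * ∑' x, q x := by
        rw [ENNReal.tsum_add, ENNReal.tsum_mul_left, tsum_eq_sum (s := D)]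
        · simp +contextual
        · simp +contextual
    _ ≤ L * (a * (L : ℝ≥0∞)⁻¹) + b * 1 := by gcongr
    _ = 1 := by
        rw [mul_left_comm, ENNReal.mul_inv_cancel hL0 (ENNReal.natCast_ne_top L), mul_one,
          mul_one, hab]

/-- A list version of Fano's inequality, in which the conditional entropy on the error event is
controlled by the surprisal of the source on that event. -/
lemma condShannonEntropy_le (μ : Measure Ω) [IsProbabilityMeasure μ] {X : Ω → ℕ}
    (hX : Measurable X) {Y : Ω → 𝓨} (hY : Measurable Y) {L : ℕ} (hL : 1 ≤ L)
    {f : 𝓨 → Finset ℕ} (hf : IsListDecoder L f) {η : ℝ} (hη : 0 < η) :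
    condShannonEntropy μ X Y ≤ ENNReal.ofReal (Real.log L + η) +
      ENNReal.ofReal (-Real.log (1 - Real.exp (-η))) * μ {ω | X ω ∉ f (Y ω)} +
      ∫⁻ ω in {ω | X ω ∉ f (Y ω)}, surprisal (law μ X (X ω)) ∂μ := by
  classical
  have hexp1 : Real.exp (-η) < 1 := by simpa using hη
  have hexp0 := Real.exp_pos (-η)
  have hLpos : (0 : ℝ) < L := by exact_mod_cast hL
  -- With `a = e^{-η}`, a letter on the list costs `log L + η`, and being off the list costs the
  -- constant `B` on top of the surprisal.
  set a := ENNReal.ofReal (Real.exp (-η)) with ha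
  set b := ENNReal.ofReal (1 - Real.exp (-η)) with hb
  have hab : a + b = 1 := by
    rw [ha, hb, ← ENNReal.ofReal_add hexp0.le (by linarith)]
    simp
  set A := ENNReal.ofReal (Real.log L + η) with hA
  set B := ENNReal.ofReal (-Real.log (1 - Real.exp (-η))) with hB
  have hsA : surprisal (a * (L : ℝ≥0∞)⁻¹) = A := by
    have : a * (L : ℝ≥0∞)⁻¹ = ENNReal.ofReal (Real.exp (-η) * (L : ℝ)⁻¹) := by
      rw [ENNReal.ofReal_mul hexp0.le, ENNReal.ofReal_inv_of_pos hLpos, ENNReal.ofReal_natCast]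
    rw [this, surprisal_ofReal (by positivity),
      Real.log_mul hexp0.ne' (by positivity), Real.log_exp, Real.log_inv]
    congr 1
    ring
  have hsB : surprisal b = B := surprisal_ofReal (by linarith)
  let F : 𝓨 × ℕ → ℝ≥0∞ :=
    fun z => if z.2 ∈ f z.1 then A else B + surprisal (law μ X z.2)
  have hF : Measurable F := by
    refine Measurable.ite hf.measurableSet_mem measurable_const ?_
    exact (measurable_from_top (f := fun x : ℕ => B + surprisal (law μ X x))).comp measurable_snd
  have hE : MeasurableSet {ω | X ω ∉ f (Y ω)} :=
    (hY.prodMk hX hf.measurableSet_mem).compl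
  calc condShannonEntropy μ X Y
      ≤ ∫⁻ ω, ∑' x, condLaw μ X Y (Y ω) x * F (Y ω, x) ∂μ := by
        refine lintegral_mono fun ω => ?_
        refine (shannonEntropy_le_tsum (tsum_condLaw μ X Y (Y ω))
          (tsum_ite_finset_le hL (hf.1 (Y ω)).2 (tsum_law μ hX).le hab)).trans ?_
        refine ENNReal.tsum_le_tsum fun x => ?_
        gcongr
        simp only [F]
        split_ifs
        · exact hsA.le
        · rw [← hsB]
          exact surprisal_mul_le _ _ (hab ▸ le_add_self) (law_le_one μ X x)
    _ = ∫⁻ ω, F (Y ω, X ω) ∂μ := lintegral_tsum_condLaw μ hX hY hF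
    _ = (∫⁻ ω in {ω | X ω ∉ f (Y ω)}, F (Y ω, X ω) ∂μ) +
          ∫⁻ ω in {ω | X ω ∉ f (Y ω)}ᶜ, F (Y ω, X ω) ∂μ := (lintegral_add_compl _ hE).symm
    _ = (∫⁻ ω in {ω | X ω ∉ f (Y ω)}, (B + surprisal (law μ X (X ω))) ∂μ) +
          ∫⁻ ω in {ω | X ω ∉ f (Y ω)}ᶜ, A ∂μ := by
        congr 1
        · refine setLIntegral_congr_fun hE fun ω hω => ?_
          simp only [F]
          exact if_neg hω
        · refine setLIntegral_congr_fun hE.compl fun ω hω => ?_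
          simp only [F]
          exact if_pos (not_not.1 hω)
    _ ≤ (B * μ {ω | X ω ∉ f (Y ω)} +
          ∫⁻ ω in {ω | X ω ∉ f (Y ω)}, surprisal (law μ X (X ω)) ∂μ) + A := by
        rw [lintegral_add_left measurable_const, setLIntegral_const, setLIntegral_const]
        gcongr
        exact mul_le_of_le_one_right' prob_le_one
    _ = _ := by rw [add_comm, add_assoc]

end Fano

/-! ### Majorization and truncated masses -/

section Rearrangement

/-- Remove a minimizer of `p` on `A`: a level below that minimum is exceeded by all `k + 1` values
on `A`, so it is not admissible in the infimum defining `decRearr p k`. -/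
lemma sum_le_sum_decRearr (p : ℕ → ℝ≥0∞) (A : Finset ℕ) :
    ∑ x ∈ A, p x ≤ ∑ i ∈ Finset.range A.card, decRearr p i := by
  induction hk : A.card generalizing A with
  | zero => simp [Finset.card_eq_zero.1 hk]
  | succ k ih =>
    have hne : A.Nonempty := Finset.card_pos.1 (by omega)
    obtain ⟨m, hmA, hm⟩ := A.exists_min_image p hne
    rw [← Finset.sum_erase_add _ _ hmA, Finset.sum_range_succ]
    refine add_le_add (ih _ (by rw [Finset.card_erase_of_mem hmA, hk]; rfl)) ?_
    refine le_sInf fun t ht => ?_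
    by_contra! hlt
    have hsub : (A : Set ℕ) ⊆ {x | t < p x} := fun x hx => hlt.trans_le (hm x hx)
    have h := (Set.encard_le_encard hsub).trans ht
    rw [Set.encard_coe_eq_coe_finsetCard, hk] at h
    norm_cast at h
    omega

/-- When `A` carries the largest values, only elements of `A` other than the minimizer can exceed
the minimum, so that minimum is an admissible level. -/
lemma sum_decRearr_le_sum (p : ℕ → ℝ≥0∞) (A : Finset ℕ)
    (hA : ∀ x ∈ A, ∀ y ∉ A, p y ≤ p x) :
    ∑ i ∈ Finset.range A.card, decRearr p i ≤ ∑ x ∈ A, p x := by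
  induction hk : A.card generalizing A with
  | zero => simp
  | succ k ih =>
    have hne : A.Nonempty := Finset.card_pos.1 (by omega)
    obtain ⟨m, hmA, hm⟩ := A.exists_min_image p hne
    rw [← Finset.sum_erase_add _ _ hmA, Finset.sum_range_succ]
    have hcard : (A.erase m).card = k := by rw [Finset.card_erase_of_mem hmA, hk]; rfl
    refine add_le_add (ih _ ?_ hcard) (sInf_le ?_)
    · intro x hx y hy
      rw [Finset.mem_erase] at hx hy
      by_cases hyA : y ∈ A
      · have : y = m := by by_contra h; exact hy ⟨h, hyA⟩
        exact this ▸ hm x hx.2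
      · exact hA x hx.2 y hyA
    · have hsub : {x | p m < p x} ⊆ ((A.erase m : Finset ℕ) : Set ℕ) := by
        intro x hx
        rw [Finset.mem_coe, Finset.mem_erase]
        refine ⟨fun h => (h ▸ hx : p m < p m).false, ?_⟩
        by_contra hxA
        exact (hA m hmA x hxA).not_gt hx
      have h := Set.encard_le_encard hsub
      rw [Set.encard_coe_eq_coe_finsetCard, hcard] at h
      exact h

lemma finite_setOf_lt_of_tsum {p : ℕ → ℝ≥0∞} (hp : ∑' x, p x ≠ ∞) {t : ℝ≥0∞} (ht : t ≠ 0) :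
    {x | t < p x}.Finite :=
  (ENNReal.finite_const_le_of_tsum_ne_top hp ht).subset fun x hx => by
    rw [Set.mem_ofPred_eq] at hx ⊢
    exact hx.le

lemma tsum_tsub_eq_sum {p : ℕ → ℝ≥0∞} {t : ℝ≥0∞} {A : Finset ℕ} (hA : ∀ x, x ∈ A ↔ t < p x) :
    ∑' x, (p x - t) = ∑ x ∈ A, (p x - t) :=
  tsum_eq_sum fun x hx => tsub_eq_zero_of_le (not_lt.1 (mt (hA x).2 hx))

lemma sum_eq_card_mul_add_tsum_tsub {p : ℕ → ℝ≥0∞} {t : ℝ≥0∞} {A : Finset ℕ}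
    (hA : ∀ x, x ∈ A ↔ t < p x) :
    ∑ x ∈ A, p x = A.card * t + ∑' x, (p x - t) := by
  rw [tsum_tsub_eq_sum hA, ← nsmul_eq_mul, ← Finset.sum_const, ← Finset.sum_add_distrib]
  exact Finset.sum_congr rfl fun x hx => (add_tsub_cancel_of_le ((hA x).1 hx).le).symm

/-- Each term is at most `t` plus its excess over `t`; the excesses vanish from index `A.card` on,
and the earlier ones add up to at most the total excess of `p`. -/
lemma sum_decRearr_le {p : ℕ → ℝ≥0∞} {t : ℝ≥0∞} (ht : t ≠ ∞) {A : Finset ℕ}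
    (hA : ∀ x, x ∈ A ↔ t < p x) (k : ℕ) :
    ∑ i ∈ Finset.range k, decRearr p i ≤ k * t + ∑' x, (p x - t) := by
  have hset : {x | t < p x} = (A : Set ℕ) := by ext x; simp [hA]
  have hle : ∀ i, A.card ≤ i → decRearr p i ≤ t := fun i hi => sInf_le <| by
    rw [Set.mem_ofPred_eq, hset, Set.encard_coe_eq_coe_finsetCard]
    exact_mod_cast hi
  have hge : ∀ i, i < A.card → t ≤ decRearr p i := fun i hi => le_sInf fun s hs => by
    by_contra! hst
    have hsub : {x | t < p x} ⊆ {x | s < p x} := fun x hx => hst.trans hx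
    have h := (Set.encard_le_encard hsub).trans hs
    rw [hset, Set.encard_coe_eq_coe_finsetCard] at h
    norm_cast at h
    omega
  have htop : ∑ i ∈ Finset.range A.card, (decRearr p i - t) ≤ ∑' x, (p x - t) := by
    have h := sum_decRearr_le_sum p A fun x hx y hy =>
      (not_lt.1 (mt (hA y).2 hy)).trans ((hA x).1 hx).le
    rw [sum_eq_card_mul_add_tsum_tsub hA] at h
    have h2 : ∑ i ∈ Finset.range A.card, decRearr p i =
        A.card * t + ∑ i ∈ Finset.range A.card, (decRearr p i - t) := by
      conv_rhs => rw [← Finset.card_range A.card, ← nsmul_eq_mul, ← Finset.sum_const,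
        Finset.card_range, ← Finset.sum_add_distrib]
      exact Finset.sum_congr rfl fun i hi =>
        (add_tsub_cancel_of_le (hge i (Finset.mem_range.1 hi))).symm
    rw [h2] at h
    exact (ENNReal.add_le_add_iff_left (ENNReal.mul_ne_top (ENNReal.natCast_ne_top _) ht)).1 h
  calc ∑ i ∈ Finset.range k, decRearr p i
      ≤ ∑ i ∈ Finset.range k, (t + (decRearr p i - t)) :=
        Finset.sum_le_sum fun i _ => le_add_tsub
    _ = k * t + ∑ i ∈ Finset.range k, (decRearr p i - t) := by
        rw [Finset.sum_add_distrib]; simp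
    _ ≤ k * t + ∑ i ∈ Finset.range A.card, (decRearr p i - t) := by
        refine add_le_add le_rfl ?_
        refine Finset.sum_le_sum_of_ne_zero fun i _ hi => Finset.mem_range.2 ?_
        by_contra! h
        exact hi (tsub_eq_zero_of_le (hle i h) : decRearr p i - t = 0)
    _ ≤ _ := by gcongr

lemma tsum_min_add_tsum_tsub (p : ℕ → ℝ≥0∞) (t : ℝ≥0∞) :
    ∑' x, min (p x) t + ∑' x, (p x - t) = ∑' x, p x := by
  rw [← ENNReal.tsum_add]
  refine tsum_congr fun x => ?_
  rcases le_total (p x) t with h | h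
  · rw [min_eq_left h, tsub_eq_zero_of_le h, add_zero]
  · rw [min_eq_right h, add_tsub_cancel_of_le h]

/-- Majorization decreases the sum of the truncated masses. -/
lemma Majorizes.tsum_min_le {q p : ℕ → ℝ≥0∞} (h : Majorizes q p) (hq : ∑' x, q x = 1)
    (hp : ∑' x, p x = 1) {t : ℝ≥0∞} (ht0 : t ≠ 0) (ht : t ≠ ∞) :
    ∑' x, min (q x) t ≤ ∑' x, min (p x) t := by
  obtain ⟨A, hA⟩ := (finite_setOf_lt_of_tsum (hp ▸ ENNReal.one_ne_top) ht0).exists_finset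
  obtain ⟨B, hB⟩ := (finite_setOf_lt_of_tsum (hq ▸ ENNReal.one_ne_top) ht0).exists_finset
  have h1 : ∑' x, (p x - t) ≤ ∑' x, (q x - t) := by
    -- At `k = A.card` the left side is exactly `k * t` plus the excess of `p`, while the right side
    -- is at most `k * t` plus the excess of `q`.
    have h2 := ((sum_le_sum_decRearr p A).trans (h A.card)).trans (sum_decRearr_le ht hB A.card)
    rw [sum_eq_card_mul_add_tsum_tsub hA] at h2
    exact (ENNReal.add_le_add_iff_left (ENNReal.mul_ne_top (ENNReal.natCast_ne_top _) ht)).1 h2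
  have hp' := tsum_min_add_tsum_tsub p t
  have hq' := tsum_min_add_tsum_tsub q t
  have hfin : ∑' x, (q x - t) ≠ ∞ :=
    ne_top_of_le_ne_top ENNReal.one_ne_top (hq ▸ hq' ▸ le_add_self)
  rw [← ENNReal.add_le_add_iff_right hfin, hq', hq, ← hp, ← hp']
  gcongr

end Rearrangement

/-! ### Excess surprisal as an integral over truncation levels -/

section LayerCake

lemma setLIntegral_Ioc_inv {a c : ℝ} (ha : 0 < a) (hac : a ≤ c) :
    ∫⁻ t in Set.Ioc a c, ENNReal.ofReal t⁻¹ = ENNReal.ofReal (Real.log c - Real.log a) := by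
  have hc := ha.trans_le hac
  rw [← Real.log_div hc.ne' ha.ne', ← integral_inv_of_pos ha hc,
    intervalIntegral.integral_of_le hac, ofReal_integral_eq_lintegral_ofReal]
  · rw [← IntegrableOn, ← intervalIntegrable_iff_integrableOn_Ioc_of_le hac]
    exact intervalIntegral.intervalIntegrable_inv (fun x hx => by
      rw [Set.uIcc_of_le hac] at hx; exact (ha.trans_le hx.1).ne') continuousOn_id
  · refine (ae_restrict_iff' measurableSet_Ioc).2 (ae_of_all _ fun t ht => ?_)
    exact inv_nonneg.2 (ha.trans ht.1).le

/-- The integral of `min(p, t) / t` over `0 < t ≤ c`. -/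
def truncIntegral (c : ℝ) (p : ℝ≥0∞) : ℝ≥0∞ :=
  ∫⁻ t in Set.Ioc 0 c, min p (ENNReal.ofReal t) * ENNReal.ofReal t⁻¹

/-- For `p < c` the levels `t` in `(p, c]` alone contribute `p (log c - log p)`. -/
lemma mul_surprisal_tsub_le_truncIntegral {p : ℝ≥0∞} (hp : p ≤ 1) {c : ℝ} (hc : 0 < c) :
    p * (surprisal p - ENNReal.ofReal (-Real.log c)) ≤ truncIntegral c p := by
  rcases eq_or_ne p 0 with rfl | hp0
  · simp
  have hp' : p ≠ ∞ := ne_top_of_le_ne_top ENNReal.one_ne_top hp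
  have ha := ENNReal.toReal_pos hp0 hp'
  obtain ⟨a, hpa, ha⟩ : ∃ a : ℝ, p = ENNReal.ofReal a ∧ 0 < a :=
    ⟨p.toReal, (ENNReal.ofReal_toReal hp').symm, ha⟩
  rcases le_total c a with hca | hac
  · rw [hpa, surprisal_ofReal ha, tsub_eq_zero_of_le, mul_zero]
    · exact zero_le
    · exact ENNReal.ofReal_le_ofReal (neg_le_neg (Real.log_le_log hc hca))
  calc p * (surprisal p - ENNReal.ofReal (-Real.log c))
      ≤ p * ENNReal.ofReal (Real.log c - Real.log a) := by
        gcongr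
        rw [hpa, surprisal_ofReal ha, tsub_le_iff_right]
        refine le_trans (le_of_eq ?_) ENNReal.ofReal_add_le
        congr 1
        ring
    _ = ∫⁻ t in Set.Ioc a c, p * ENNReal.ofReal t⁻¹ := by
        rw [lintegral_const_mul' _ _ hp', setLIntegral_Ioc_inv ha hac]
    _ = ∫⁻ t in Set.Ioc a c, min p (ENNReal.ofReal t) * ENNReal.ofReal t⁻¹ := by
        refine setLIntegral_congr_fun measurableSet_Ioc fun t ht => ?_
        rw [min_eq_left]
        rw [hpa]
        exact ENNReal.ofReal_le_ofReal ht.1.le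
    _ ≤ truncIntegral c p := lintegral_mono_set (Set.Ioc_subset_Ioc_left ha.le)

/-- Split at `t = p`: the integrand is at most `1` below and `p / t` above. -/
lemma truncIntegral_one_le {p : ℝ≥0∞} (hp : p ≤ 1) :
    truncIntegral 1 p ≤ p + p * surprisal p := by
  rcases eq_or_ne p 0 with rfl | hp0
  · simp [truncIntegral]
  have hp' : p ≠ ∞ := ne_top_of_le_ne_top ENNReal.one_ne_top hp
  obtain ⟨a, hpa, ha⟩ : ∃ a : ℝ, p = ENNReal.ofReal a ∧ 0 < a :=
    ⟨p.toReal, (ENNReal.ofReal_toReal hp').symm, ENNReal.toReal_pos hp0 hp'⟩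
  have ha1 : a ≤ 1 := by simpa [hpa] using hp
  rw [truncIntegral, ← Set.Ioc_union_Ioc_eq_Ioc ha.le ha1]
  refine (lintegral_union_le _ _ _).trans (add_le_add ?_ ?_)
  · calc ∫⁻ t in Set.Ioc 0 a, min p (ENNReal.ofReal t) * ENNReal.ofReal t⁻¹
        ≤ ∫⁻ t in Set.Ioc 0 a, 1 := by
          refine setLIntegral_mono measurable_const fun t ht => ?_
          calc min p (ENNReal.ofReal t) * ENNReal.ofReal t⁻¹
              ≤ ENNReal.ofReal t * ENNReal.ofReal t⁻¹ := by gcongr; exact min_le_right _ _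
            _ = 1 := by
              rw [← ENNReal.ofReal_mul ht.1.le, mul_inv_cancel₀ ht.1.ne', ENNReal.ofReal_one]
      _ = p := by simp [hpa]
  · calc ∫⁻ t in Set.Ioc a 1, min p (ENNReal.ofReal t) * ENNReal.ofReal t⁻¹
        ≤ ∫⁻ t in Set.Ioc a 1, p * ENNReal.ofReal t⁻¹ := by
          refine lintegral_mono fun t => ?_
          gcongr
          exact min_le_left _ _
      _ = p * surprisal p := by
          rw [lintegral_const_mul' _ _ hp', setLIntegral_Ioc_inv ha ha1, hpa,
            surprisal_ofReal ha]
          simp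

lemma tsum_truncIntegral (c : ℝ) (p : ℕ → ℝ≥0∞) :
    ∑' x, truncIntegral c (p x) =
      ∫⁻ t in Set.Ioc 0 c, (∑' x, min (p x) (ENNReal.ofReal t)) * ENNReal.ofReal t⁻¹ := by
  simp only [truncIntegral, ← ENNReal.tsum_mul_right]
  rw [lintegral_tsum]
  intro x
  fun_prop

lemma Majorizes.tsum_truncIntegral_le {q p : ℕ → ℝ≥0∞} (h : Majorizes q p)
    (hq : ∑' x, q x = 1) (hp : ∑' x, p x = 1) (c : ℝ) :
    ∑' x, truncIntegral c (q x) ≤ ∑' x, truncIntegral c (p x) := by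
  rw [tsum_truncIntegral, tsum_truncIntegral]
  refine lintegral_mono_ae ((ae_restrict_iff' measurableSet_Ioc).2 (ae_of_all _ fun t ht => ?_))
  gcongr ?_ * _
  exact h.tsum_min_le hq hp (by simpa using ht.1) ENNReal.ofReal_ne_top

/-- Finite entropy makes the integral over `(0, 1]` finite, and absolute continuity makes it small
over `(0, c]`. -/
lemma exists_tsum_truncIntegral_le {p : ℕ → ℝ≥0∞} (hp : ∑' x, p x = 1)
    (hH : shannonEntropy p ≠ ∞) {η : ℝ≥0∞} (hη : η ≠ 0) :
    ∃ c : ℝ, 0 < c ∧ ∑' x, truncIntegral c (p x) ≤ η := by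
  have hp1 : ∀ x, p x ≤ 1 := fun x => hp ▸ ENNReal.le_tsum x
  have hfin : ∑' x, truncIntegral 1 (p x) ≠ ∞ := by
    refine ne_top_of_le_ne_top (ENNReal.add_ne_top.2 ⟨ENNReal.one_ne_top, hH⟩)
      (b := 1 + shannonEntropy p) ?_
    rw [← hp, shannonEntropy, ← ENNReal.tsum_add]
    refine ENNReal.tsum_le_tsum fun x => ?_
    rw [ofReal_negMulLog_eq (hp1 x)]
    exact truncIntegral_one_le (hp1 x)
  rw [tsum_truncIntegral] at hfin
  obtain ⟨δ, hδ, h⟩ := exists_pos_setLIntegral_lt_of_measure_lt hfin hη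
  have hδ' : min δ 1 ≠ ∞ := ne_top_of_le_ne_top ENNReal.one_ne_top (min_le_right _ _)
  have hc : 0 < (min δ 1).toReal := ENNReal.toReal_pos (lt_min hδ one_pos).ne' hδ'
  have hc1 : (min δ 1).toReal ≤ 1 :=
    ENNReal.toReal_le_of_le_ofReal zero_le_one (by simp)
  -- Halving makes the length strictly less than `δ`; the minimum with `1` keeps it finite and the
  -- interval inside `(0, 1]`.
  refine ⟨(min δ 1).toReal / 2, by positivity, ?_⟩
  have hsub : Set.Ioc 0 ((min δ 1).toReal / 2) ⊆ Set.Ioc 0 1 :=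
    Set.Ioc_subset_Ioc_right (by linarith)
  have h2 := h (Set.Ioc 0 ((min δ 1).toReal / 2)) ?_
  · rw [Measure.restrict_restrict measurableSet_Ioc, Set.inter_eq_left.2 hsub] at h2
    rw [tsum_truncIntegral]
    exact h2.le
  · refine (Measure.restrict_le_self _).trans_lt ?_
    rw [Real.volume_Ioc, sub_zero]
    calc ENNReal.ofReal ((min δ 1).toReal / 2) < ENNReal.ofReal (min δ 1).toReal :=
          (ENNReal.ofReal_lt_ofReal_iff hc).2 (by linarith)
      _ ≤ δ := by rw [ENNReal.ofReal_toReal hδ']; exact min_le_left _ _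

lemma mul_surprisal_tsub_le {p : ℝ≥0∞} (hp : p ≤ 1) {c : ℝ} (hc : 0 < c) :
    p * (surprisal p - ENNReal.ofReal (-Real.log c)) ≤ ENNReal.ofReal c := by
  refine (mul_surprisal_tsub_le_truncIntegral hp hc).trans ?_
  calc truncIntegral c p ≤ ∫⁻ t in Set.Ioc 0 c, 1 := by
        refine setLIntegral_mono measurable_const fun t ht => ?_
        calc min p (ENNReal.ofReal t) * ENNReal.ofReal t⁻¹
            ≤ ENNReal.ofReal t * ENNReal.ofReal t⁻¹ := by gcongr; exact min_le_right _ _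
          _ = 1 := by
            rw [← ENNReal.ofReal_mul ht.1.le, mul_inv_cancel₀ ht.1.ne', ENNReal.ofReal_one]
    _ = ENNReal.ofReal c := by simp

end LayerCake

/-! ### Uniform integrability of the surprisals -/

section UniformIntegrability

variable {Ω : ℕ → Type*} [∀ n, MeasurableSpace (Ω n)] {μ : ∀ n, Measure (Ω n)}
  {X : ∀ n, Ω n → ℕ}

/-- Asymptotic uniform integrability of the surprisals of a general source: their integrals over
events of small probability are eventually small. -/
def UnifIntegrableSurprisal (μ : ∀ n, Measure (Ω n)) (X : ∀ n, Ω n → ℕ) : Prop :=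
  ∀ η : ℝ≥0∞, η ≠ 0 → ∃ δ : ℝ≥0∞, δ ≠ 0 ∧ ∀ᶠ n in atTop, ∀ E : Set (Ω n), MeasurableSet E →
    μ n E ≤ δ → ∫⁻ ω in E, surprisal (law (μ n) (X n) (X n ω)) ∂μ n ≤ η

lemma unifIntegrableSurprisal_of_tsub (hX : ∀ n, Measurable (X n))
    (h : ∀ η : ℝ≥0∞, η ≠ 0 → ∃ K : ℝ≥0∞, K ≠ ∞ ∧ ∀ᶠ n in atTop,
      ∑' x, law (μ n) (X n) x * (surprisal (law (μ n) (X n) x) - K) ≤ η) :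
    UnifIntegrableSurprisal μ X := by
  intro η hη
  have hη2 : η / 2 ≠ 0 := by simpa using hη
  obtain ⟨K, hK, hev⟩ := h (η / 2) hη2
  -- The part of the surprisal below `K` integrates to at most `K * δ ≤ η / 2`; if `K = 0`, then `δ
  -- = ∞` is harmless.
  refine ⟨η / 2 / K, by simpa [ENNReal.div_eq_zero_iff, hK] using hη, ?_⟩
  filter_upwards [hev] with n hn E _ hE
  calc ∫⁻ ω in E, surprisal (law (μ n) (X n) (X n ω)) ∂μ n
      ≤ ∫⁻ ω in E, (K + (surprisal (law (μ n) (X n) (X n ω)) - K)) ∂μ n :=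
        lintegral_mono fun ω => le_add_tsub
    _ = K * μ n E + ∫⁻ ω in E, (surprisal (law (μ n) (X n) (X n ω)) - K) ∂μ n := by
        rw [lintegral_add_left measurable_const, setLIntegral_const]
    _ ≤ K * (η / 2 / K) + ∫⁻ ω, (surprisal (law (μ n) (X n) (X n ω)) - K) ∂μ n := by
        gcongr
        exact Measure.restrict_le_self
    _ ≤ η / 2 + η / 2 := by
        gcongr
        · exact ENNReal.mul_div_le
        · rwa [lintegral_comp_eq_tsum_law (μ n) (hX n)
            (fun x => surprisal (law (μ n) (X n) x) - K)]
    _ = η := ENNReal.add_halves η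

lemma unifIntegrableSurprisal_of_majorizes [∀ n, IsProbabilityMeasure (μ n)]
    (hX : ∀ n, Measurable (X n)) {p : ℕ → ℝ≥0∞} (hp : ∑' x, p x = 1)
    (hH : shannonEntropy p ≠ ∞) (h : ∀ᶠ n in atTop, Majorizes (law (μ n) (X n)) p) :
    UnifIntegrableSurprisal μ X := by
  refine unifIntegrableSurprisal_of_tsub hX fun η hη => ?_
  obtain ⟨c, hc, hcη⟩ := exists_tsum_truncIntegral_le hp hH hη
  refine ⟨ENNReal.ofReal (-Real.log c), ENNReal.ofReal_ne_top, ?_⟩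
  filter_upwards [h] with n hn
  exact ((ENNReal.tsum_le_tsum fun x =>
    mul_surprisal_tsub_le_truncIntegral (law_le_one (μ n) (X n) x) hc).trans
      (hn.tsum_truncIntegral_le (tsum_law (μ n) (hX n)) hp c)).trans hcη

lemma sum_add_tsum_eq_shannonEntropy (p : ℕ → ℝ≥0∞) (S : Finset ℕ) :
    ∑ x ∈ S, ENNReal.ofReal (Real.negMulLog (p x).toReal) +
      ∑' x : ((S : Set ℕ)ᶜ : Set ℕ), ENNReal.ofReal (Real.negMulLog (p x).toReal) =
        shannonEntropy p :=
  ENNReal.sum_add_tsum_compl S fun x => ENNReal.ofReal (Real.negMulLog (p x).toReal)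

lemma tsum_mul_surprisal_tsub_le {p : ℕ → ℝ≥0∞} (hp : ∀ x, p x ≤ 1) {c : ℝ} (hc : 0 < c)
    (S : Finset ℕ) :
    ∑' x, p x * (surprisal (p x) - ENNReal.ofReal (-Real.log c)) ≤ S.card * ENNReal.ofReal c +
      ∑' x : ((S : Set ℕ)ᶜ : Set ℕ), ENNReal.ofReal (Real.negMulLog (p x).toReal) := by
  rw [← ENNReal.sum_add_tsum_compl S]
  refine add_le_add ?_ (ENNReal.tsum_le_tsum fun x => ?_)
  · rw [← nsmul_eq_mul, ← Finset.sum_const]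
    exact Finset.sum_le_sum fun x _ => mul_surprisal_tsub_le (hp x) hc
  · rw [ofReal_negMulLog_eq (hp x)]
    exact mul_le_mul_right tsub_le_self _

lemma tendsto_sum_negMulLog {q : ℕ → ℕ → ℝ≥0∞} {p : ℕ → ℝ≥0∞} (hp : ∀ x, p x ≤ 1)
    (h : ∀ x, Tendsto (fun n => q n x) atTop (𝓝 (p x))) (S : Finset ℕ) :
    Tendsto (fun n => ∑ x ∈ S, ENNReal.ofReal (Real.negMulLog (q n x).toReal)) atTop
      (𝓝 (∑ x ∈ S, ENNReal.ofReal (Real.negMulLog (p x).toReal))) :=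
  tendsto_finsetSum _ fun x _ => ENNReal.tendsto_ofReal
    ((Real.continuous_negMulLog.tendsto _).comp ((ENNReal.tendsto_toReal
      (ne_top_of_le_ne_top ENNReal.one_ne_top (hp x))).comp (h x)))

lemma exists_tail_negMulLog_le {q : ℕ → ℕ → ℝ≥0∞} {p : ℕ → ℝ≥0∞} (hp : ∀ x, p x ≤ 1)
    (hH : shannonEntropy p ≠ ∞) (h : ∀ x, Tendsto (fun n => q n x) atTop (𝓝 (p x)))
    (hent : Tendsto (fun n => shannonEntropy (q n)) atTop (𝓝 (shannonEntropy p)))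
    {η : ℝ≥0∞} (hη : η ≠ 0) :
    ∃ S : Finset ℕ, ∀ᶠ n in atTop,
      ∑' x : ((S : Set ℕ)ᶜ : Set ℕ), ENNReal.ofReal (Real.negMulLog (q n x).toReal) ≤ η := by
  obtain ⟨S, hS⟩ : ∃ S : Finset ℕ, shannonEntropy p <
      ∑ x ∈ S, ENNReal.ofReal (Real.negMulLog (p x).toReal) + η := by
    have h1 : Tendsto (fun S : Finset ℕ =>
        ∑ x ∈ S, ENNReal.ofReal (Real.negMulLog (p x).toReal) + η) atTop
        (𝓝 (shannonEntropy p + η)) :=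
      Tendsto.add ENNReal.summable.hasSum tendsto_const_nhds
    exact (h1.eventually_const_lt (ENNReal.lt_add_right hH hη)).exists
  refine ⟨S, ?_⟩
  -- The strict inequality at the limit passes to large `n`; cancelling the finite sum over `S`
  -- leaves the tail.
  filter_upwards [hent.eventually_lt
    ((tendsto_sum_negMulLog hp h S).add tendsto_const_nhds) hS] with n hn
  rw [← sum_add_tsum_eq_shannonEntropy (q n) S] at hn
  exact (ENNReal.add_le_add_iff_left
    (ENNReal.sum_ne_top.2 fun x _ => ENNReal.ofReal_ne_top)).1 hn.le

lemma unifIntegrableSurprisal_of_tendsto [∀ n, IsProbabilityMeasure (μ n)]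
    (hX : ∀ n, Measurable (X n)) {p : ℕ → ℝ≥0∞} (hp1 : ∀ x, p x ≤ 1)
    (hH : shannonEntropy p ≠ ∞) (hlaw : ∀ x, Tendsto (fun n => law (μ n) (X n) x) atTop (𝓝 (p x)))
    (hent : Tendsto (fun n => shannonEntropy (law (μ n) (X n))) atTop (𝓝 (shannonEntropy p))) :
    UnifIntegrableSurprisal μ X := by
  refine unifIntegrableSurprisal_of_tsub hX fun η hη => ?_
  have hη2 : η / 2 ≠ 0 := by simpa using hη
  obtain ⟨S, hS⟩ := exists_tail_negMulLog_le hp1 hH hlaw hent hη2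
  obtain ⟨c, hc, hcη⟩ : ∃ c : ℝ, 0 < c ∧ S.card * ENNReal.ofReal c ≤ η / 2 := by
    -- The minimum with `1` keeps `c` finite when `S` is empty or `η = ∞`.
    have hr0 : min (η / 2 / S.card) 1 ≠ 0 :=
      (lt_min (ENNReal.div_pos hη2 (ENNReal.natCast_ne_top _)) one_pos).ne'
    have hrtop : min (η / 2 / S.card) 1 ≠ ∞ :=
      ne_top_of_le_ne_top ENNReal.one_ne_top (min_le_right _ _)
    refine ⟨(min (η / 2 / S.card) 1).toReal, ENNReal.toReal_pos hr0 hrtop, ?_⟩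
    rw [ENNReal.ofReal_toReal hrtop]
    exact (mul_le_mul_right (min_le_left _ _) _).trans ENNReal.mul_div_le
  refine ⟨ENNReal.ofReal (-Real.log c), ENNReal.ofReal_ne_top, ?_⟩
  filter_upwards [hS] with n hn
  exact (tsum_mul_surprisal_tsub_le (law_le_one (μ n) (X n)) hc S).trans
    ((add_le_add hcη hn).trans (ENNReal.add_halves η).le)

lemma tendsto_law_of_tendstoInDistribution [∀ n, IsProbabilityMeasure (μ n)]
    {Ω' : Type*} [MeasurableSpace Ω'] {ν : Measure Ω'} [IsProbabilityMeasure ν] {Z : Ω' → ℕ}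
    (hX : ∀ n, Measurable (X n)) (hZ : Measurable Z) (h : TendstoInDistribution X atTop Z μ ν)
    (x : ℕ) : Tendsto (fun n => law (μ n) (X n) x) atTop (𝓝 (law ν Z x)) := by
  have h2 := ProbabilityMeasure.tendsto_measure_of_null_frontier_of_tendsto' h.tendsto
    (E := {x}) (by simp)
  simpa [Measure.map_apply (hX _) (measurableSet_singleton x),
    Measure.map_apply hZ (measurableSet_singleton x), law] using h2

/-- Off the bad event the surprisal is at least `(1 - d) H`, so the complement of any small `E`
carries nearly the whole integral `H`, leaving little for `E`. -/
lemma unifIntegrableSurprisal_of_aep [∀ n, IsProbabilityMeasure (μ n)]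
    (hX : ∀ n, Measurable (X n)) (haep : AEP μ X) {C : ℝ≥0}
    (hC : ∀ᶠ n in atTop, shannonEntropy (law (μ n) (X n)) ≤ C) :
    UnifIntegrableSurprisal μ X := by
  intro η hη
  obtain ⟨d, hd0, hdη⟩ : ∃ d : ℝ≥0, d ≠ 0 ∧ (C : ℝ≥0∞) * (d + (d + d)) ≤ η ∧ d ≤ 1 := by
    set r : ℝ≥0∞ := min (η / C / 3) 1 with hr
    have hr0 : r ≠ 0 := by
      refine (lt_min (ENNReal.div_pos ?_ (by simp)) one_pos).ne'
      exact (ENNReal.div_pos hη ENNReal.coe_ne_top).ne'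
    have hrtop : r ≠ ∞ := ne_top_of_le_ne_top ENNReal.one_ne_top (min_le_right _ _)
    refine ⟨r.toNNReal, ?_, ?_, ?_⟩
    · simp [ENNReal.toNNReal_eq_zero_iff, hr0, hrtop]
    · rw [ENNReal.coe_toNNReal hrtop]
      have h3 : r + (r + r) = 3 * r := by ring
      rw [h3]
      calc (C : ℝ≥0∞) * (3 * r) ≤ C * (3 * (η / C / 3)) := by gcongr; exact min_le_left _ _
        _ ≤ C * (η / C) := by gcongr; exact ENNReal.mul_div_le
        _ ≤ η := ENNReal.mul_div_le
    · rw [← ENNReal.coe_le_coe, ENNReal.coe_toNNReal hrtop]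
      exact min_le_right _ _
  obtain ⟨hdη, hd1⟩ := hdη
  have hd0' : (d : ℝ≥0∞) ≠ 0 := by simpa using hd0
  have hpos : (0 : ℝ) < d := by simpa [pos_iff_ne_zero] using hd0
  refine ⟨d, hd0', ?_⟩
  filter_upwards [hC, (haep d hpos).eventually_lt_const (pos_iff_ne_zero.2 hd0')]
    with n hCn hbad E hE hμE
  set H := shannonEntropy (law (μ n) (X n)) with hH
  set bad := {ω | ENNReal.log (law (μ n) (X n) (X n ω))⁻¹ ≤
    ((1 - (d : ℝ) : ℝ) : EReal) * (H : EReal)}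
  have hbadm : MeasurableSet bad := hX n (DiscreteMeasurableSpace.forall_measurableSet
    {x | ENNReal.log (law (μ n) (X n) x)⁻¹ ≤ ((1 - (d : ℝ) : ℝ) : EReal) * (H : EReal)})
  have hHfin : H ≠ ∞ := ne_top_of_le_ne_top ENNReal.coe_ne_top hCn
  let U : Ω n → ℝ≥0∞ := fun ω => surprisal (law (μ n) (X n) (X n ω))
  have hsplit : ∫⁻ ω in E, U ω ∂μ n + ∫⁻ ω in Eᶜ, U ω ∂μ n = H := by
    rw [lintegral_add_compl _ hE, hH, shannonEntropy_law (μ n) (hX n)]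
  have hUfin : ∫⁻ ω in Eᶜ, U ω ∂μ n ≠ ∞ := ne_top_of_le_ne_top hHfin (hsplit ▸ le_add_self)
  have hgood : ∀ ω ∈ Eᶜ \ bad, ENNReal.ofReal (1 - d) * H ≤ U ω := by
    intro ω hω
    have h1 := lt_of_not_ge (mt Set.mem_ofPred.2 hω.2)
    have h2 := EReal.toENNReal_le_toENNReal h1.le
    rwa [EReal.toENNReal_mul (EReal.coe_nonneg.2 (sub_nonneg.2 (by exact_mod_cast hd1))),
      EReal.real_coe_toENNReal, EReal.toENNReal_coe] at h2
  have hlow : ENNReal.ofReal (1 - d) * H * μ n (Eᶜ \ bad) ≤ ∫⁻ ω in Eᶜ, U ω ∂μ n := by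
    rw [← setLIntegral_const]
    exact (setLIntegral_mono' (hE.compl.diff hbadm) hgood).trans
      (lintegral_mono_set Set.sdiff_subset)
  have hone : 1 ≤ μ n (Eᶜ \ bad) + (μ n E + μ n bad) := by
    rw [← measure_univ (μ := μ n)]
    refine (measure_mono (t := (Eᶜ \ bad) ∪ (E ∪ bad)) fun ω _ => ?_).trans
      ((measure_union_le _ _).trans (add_le_add_right (measure_union_le _ _) _))
    by_cases h1 : ω ∈ E <;> by_cases h2 : ω ∈ bad <;> simp [h1, h2]
  have hd1' : ENNReal.ofReal (1 - d) + d = 1 := by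
    rw [← ENNReal.ofReal_coe_nnreal, ← ENNReal.ofReal_add (by simpa using hd1) hpos.le]
    simp
  -- Three losses of at most `d * H` each: from the factor `1 - d`, from `E` and from the bad event.
  have hle : H ≤ H * (d + (d + d)) + ∫⁻ ω in Eᶜ, U ω ∂μ n := by
    calc H = d * H + ENNReal.ofReal (1 - d) * H * 1 := by
          rw [mul_one, ← add_mul, add_comm, hd1', one_mul]
      _ ≤ d * H + ENNReal.ofReal (1 - d) * H * (μ n (Eᶜ \ bad) + (μ n E + μ n bad)) := by
          gcongr
      _ = d * H + (ENNReal.ofReal (1 - d) * H * μ n (Eᶜ \ bad) +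
            ENNReal.ofReal (1 - d) * H * (μ n E + μ n bad)) := by rw [mul_add]
      _ ≤ d * H + (∫⁻ ω in Eᶜ, U ω ∂μ n + 1 * H * (d + d)) := by
          gcongr
          exact hd1' ▸ le_self_add
      _ = _ := by ring
  rw [← hsplit] at hle
  refine ((ENNReal.add_le_add_iff_right hUfin).1 hle).trans (le_trans ?_ hdη)
  rw [hsplit]
  gcongr

end UniformIntegrability

/-! ### Rényi bounds for α > 1 -/

section Renyi

lemma sum_rpow_le_mul_tsum_rpow {α : ℝ} (hα : 1 ≤ α) {L : ℕ} {D : Finset ℕ}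
    (hD : D.card ≤ L) (p : ℕ → ℝ≥0∞) :
    (∑ x ∈ D, p x) ^ α ≤ (L : ℝ≥0∞) ^ (α - 1) * ∑' x, p x ^ α :=
  calc (∑ x ∈ D, p x) ^ α ≤ (D.card : ℝ≥0∞) ^ (α - 1) * ∑ x ∈ D, p x ^ α :=
        ENNReal.rpow_sum_le_const_mul_sum_rpow D p hα
    _ ≤ _ := by
        gcongr
        exact ENNReal.sum_le_tsum D

lemma lintegral_rpow_le_lintegral_rpow {Ω : Type*} [MeasurableSpace Ω] (μ : Measure Ω)
    [IsProbabilityMeasure μ] {α : ℝ} (hα : 1 ≤ α) {g : Ω → ℝ≥0∞} (hg : Measurable g) :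
    (∫⁻ ω, g ω ∂μ) ^ α ≤ ∫⁻ ω, g ω ^ α ∂μ := by
  have h := eLpNorm'_le_eLpNorm'_of_exponent_le one_pos hα μ hg.aestronglyMeasurable
  have hα0 : 0 < α := by linarith
  simp only [eLpNorm', enorm_eq_self, ENNReal.rpow_one, div_one] at h
  simpa [← ENNReal.rpow_mul, hα0.ne'] using ENNReal.rpow_le_rpow h hα0.le

/-- Turns a lower bound on the integral into an upper bound on the entropy, since the prefactor `c`
is nonpositive. -/
lemma coe_mul_log_le {c u v : ℝ} (hc : c ≤ 0) {I : ℝ≥0∞}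
    (h : ENNReal.ofReal (Real.exp u) ≤ ENNReal.ofReal (Real.exp v) * I) :
    (c : EReal) * ENNReal.log I ≤ ((c * (u - v) : ℝ) : EReal) := by
  have hI : ENNReal.ofReal (Real.exp (u - v)) ≤ I := by
    rw [Real.exp_sub, ENNReal.ofReal_div_of_pos (Real.exp_pos v)]
    exact ENNReal.div_le_of_le_mul' h
  have hlog : ((u - v : ℝ) : EReal) ≤ ENNReal.log I := by
    have h2 := ENNReal.log_le_log hI
    rwa [ENNReal.log_ofReal_of_pos (Real.exp_pos _), Real.log_exp] at h2
  rw [EReal.coe_mul, mul_comm, mul_comm (c : EReal)]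
  exact EReal.mul_le_mul_of_nonpos_right hlog (EReal.coe_nonpos.2 hc)

lemma natCast_rpow_eq_ofReal_exp {L : ℕ} (hL : 1 ≤ L) (s : ℝ) :
    (L : ℝ≥0∞) ^ s = ENNReal.ofReal (Real.exp (s * Real.log L)) := by
  have hLpos : (0 : ℝ) < L := by exact_mod_cast hL
  rw [← ENNReal.ofReal_natCast, ENNReal.ofReal_rpow_of_pos hLpos, Real.rpow_def_of_pos hLpos,
    mul_comm]

variable {Ω 𝓨 : Type*} [MeasurableSpace Ω] [MeasurableSpace 𝓨]
  (μ : Measure Ω) [IsProbabilityMeasure μ] {X : Ω → ℕ} {Y : Ω → 𝓨} {L : ℕ} {f : 𝓨 → Finset ℕ}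

/-- The conditional probability, given `Y = y`, that the list `f y` contains `X`. -/
def condSuccess (X : Ω → ℕ) (Y : Ω → 𝓨) (f : 𝓨 → Finset ℕ) (y : 𝓨) : ℝ≥0∞ :=
  ∑ x ∈ f y, condLaw μ X Y y x

/-- A sum over all letters, with an indicator in place of the varying list, gives access to
measurability and disintegration. -/
lemma condSuccess_eq_tsum (X : Ω → ℕ) (Y : Ω → 𝓨) (f : 𝓨 → Finset ℕ) (y : 𝓨) :
    condSuccess μ X Y f y =
      ∑' x, condLaw μ X Y y x * {z : 𝓨 × ℕ | z.2 ∈ f z.1}.indicator 1 (y, x) := by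
  rw [tsum_eq_sum (s := f y) fun x hx => by simp [hx], condSuccess]
  exact Finset.sum_congr rfl fun x hx => by simp [hx]

lemma measurable_condSuccess (X : Ω → ℕ) (Y : Ω → 𝓨) (hf : IsListDecoder L f) :
    Measurable (condSuccess μ X Y f) := by
  have h : condSuccess μ X Y f = fun y =>
      ∑' x, condLaw μ X Y y x * {z : 𝓨 × ℕ | z.2 ∈ f z.1}.indicator 1 (y, x) :=
    funext (condSuccess_eq_tsum μ X Y f)
  rw [h]
  exact Measurable.tsum fun x => (measurable_condLaw μ X Y x).mul
    ((measurable_one.indicator hf.measurableSet_mem).comp measurable_prodMk_right)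

lemma lintegral_condSuccess (hX : Measurable X) (hY : Measurable Y) (hf : IsListDecoder L f) :
    ∫⁻ ω, condSuccess μ X Y f (Y ω) ∂μ = μ {ω | X ω ∈ f (Y ω)} := by
  simp only [condSuccess_eq_tsum]
  rw [lintegral_tsum_condLaw μ hX hY (measurable_one.indicator hf.measurableSet_mem)]
  exact lintegral_indicator_one (hY.prodMk hX hf.measurableSet_mem)

lemma condSuccess_rpow_le {α : ℝ} (hα : 1 ≤ α) (hL : 1 ≤ L) (hf : IsListDecoder L f) (y : 𝓨) :
    condSuccess μ X Y f y ^ α ≤ ENNReal.ofReal (Real.exp ((α - 1) * Real.log L)) *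
      ∑' x, condLaw μ X Y y x ^ α := by
  rw [← natCast_rpow_eq_ofReal_exp hL]
  exact sum_rpow_le_mul_tsum_rpow hα (hf.1 y).2 _

lemma hayashiEntropy_le {α : ℝ} (hα : 1 < α) (hX : Measurable X) (hY : Measurable Y)
    (hL : 1 ≤ L) (hf : IsListDecoder L f) {η : ℝ}
    -- The α-th power of this threshold is `e^{-η(α-1)}`, which the prefactor `1 / (1 - α)` turns
    -- into exactly `η`.
    (h : ENNReal.ofReal (Real.exp (-(η * (α - 1) / α))) ≤ μ {ω | X ω ∈ f (Y ω)}) :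
    hayashiEntropy α μ X Y ≤ ((Real.log L + η : ℝ) : EReal) := by
  have hα0 : 0 < α := by linarith
  have hα1 : α - 1 ≠ 0 := by linarith
  have hα2 : 1 - α ≠ 0 := by linarith
  rw [hayashiEntropy, if_neg hα.ne']
  refine (coe_mul_log_le (u := -(η * (α - 1))) (v := (α - 1) * Real.log L)
    (one_div_nonpos.2 (by linarith)) ?_).trans
    (EReal.coe_le_coe_iff.2 (le_of_eq (by field_simp; ring)))
  calc ENNReal.ofReal (Real.exp (-(η * (α - 1))))
      = ENNReal.ofReal (Real.exp (-(η * (α - 1) / α))) ^ α := by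
        rw [ENNReal.ofReal_rpow_of_pos (Real.exp_pos _), ← Real.exp_mul]
        congr 2
        field_simp
    _ ≤ (∫⁻ ω, condSuccess μ X Y f (Y ω) ∂μ) ^ α := by
        rw [lintegral_condSuccess μ hX hY hf]
        gcongr
    _ ≤ ∫⁻ ω, condSuccess μ X Y f (Y ω) ^ α ∂μ :=
        lintegral_rpow_le_lintegral_rpow μ hα.le ((measurable_condSuccess μ X Y hf).comp hY)
    _ ≤ ∫⁻ ω, ENNReal.ofReal (Real.exp ((α - 1) * Real.log L)) *
          alphaNorm α (condLaw μ X Y (Y ω)) ^ α ∂μ := by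
        refine lintegral_mono fun ω => ?_
        rw [alphaNorm, ← ENNReal.rpow_mul, one_div_mul_cancel hα0.ne', ENNReal.rpow_one]
        exact condSuccess_rpow_le μ hα.le hL hf (Y ω)
    _ = _ := lintegral_const_mul' _ _ ENNReal.ofReal_ne_top

/-- Here the α-th root of the pointwise bound is integrated directly, without Jensen's inequality.
-/
lemma arimotoEntropy_le {α : ℝ} (hα : 1 < α) (hX : Measurable X) (hY : Measurable Y)
    (hL : 1 ≤ L) (hf : IsListDecoder L f) {η : ℝ}
    (h : ENNReal.ofReal (Real.exp (-(η * (α - 1) / α))) ≤ μ {ω | X ω ∈ f (Y ω)}) :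
    arimotoEntropy α μ X Y ≤ ((Real.log L + η : ℝ) : EReal) := by
  have hα0 : 0 < α := by linarith
  have hα1 : α - 1 ≠ 0 := by linarith
  have hα2 : 1 - α ≠ 0 := by linarith
  rw [arimotoEntropy, if_neg hα.ne']
  refine (coe_mul_log_le (u := -(η * (α - 1) / α)) (v := (α - 1) * Real.log L * (1 / α))
    (div_nonpos_of_nonneg_of_nonpos hα0.le (by linarith)) ?_).trans
    (EReal.coe_le_coe_iff.2 (le_of_eq (by field_simp; ring)))
  calc ENNReal.ofReal (Real.exp (-(η * (α - 1) / α)))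
      ≤ ∫⁻ ω, condSuccess μ X Y f (Y ω) ∂μ := by rwa [lintegral_condSuccess μ hX hY hf]
    _ ≤ ∫⁻ ω, ENNReal.ofReal (Real.exp ((α - 1) * Real.log L * (1 / α))) *
          alphaNorm α (condLaw μ X Y (Y ω)) ∂μ := by
        refine lintegral_mono fun ω => ?_
        have h2 := ENNReal.rpow_le_rpow (condSuccess_rpow_le (X := X) (Y := Y) μ hα.le hL hf (Y ω))
          (one_div_nonneg.2 hα0.le)
        rwa [← ENNReal.rpow_mul, mul_one_div_cancel hα0.ne', ENNReal.rpow_one,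
          ENNReal.mul_rpow_of_nonneg _ _ (one_div_nonneg.2 hα0.le),
          ENNReal.ofReal_rpow_of_pos (Real.exp_pos _), ← Real.exp_mul] at h2
    _ = _ := lintegral_const_mul' _ _ ENNReal.ofReal_ne_top

end Renyi

/-! ### Passage to the limit -/

section Limit

lemma tendsto_max_zero_sub {u : ℕ → EReal} {v : ℕ → ℝ}
    (h : ∀ η : ℝ, 0 < η → ∀ᶠ n in atTop, u n ≤ ((v n + η : ℝ) : EReal)) :
    Tendsto (fun n => max 0 (u n - (v n : EReal))) atTop (𝓝 0) := by
  refine tendsto_order.2 ⟨fun a ha => Eventually.of_forall fun n => ha.trans_le (le_max_left _ _),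
    fun a ha => ?_⟩
  obtain ⟨η, hη0, hηa⟩ := EReal.lt_iff_exists_real_btwn.1 ha
  filter_upwards [h η (EReal.coe_pos.1 hη0)] with n hn
  refine (max_le hη0.le ?_).trans_lt hηa
  rw [EReal.sub_le_iff_le_add (Or.inl (EReal.coe_ne_bot _)) (Or.inl (EReal.coe_ne_top _)),
    ← EReal.coe_add, add_comm η]
  exact hn

variable {Ω : ℕ → Type*} [∀ n, MeasurableSpace (Ω n)] {μ : ∀ n, Measure (Ω n)}
  {𝓨 : ℕ → Type*} [∀ n, MeasurableSpace (𝓨 n)]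
  {X : ∀ n, Ω n → ℕ} {Y : ∀ n, Ω n → 𝓨 n} {L : ℕ → ℕ}

lemma eventually_exists_isListDecoder
    (hε : Tendsto (fun n => listError (L n) (μ n) (X n) (Y n)) atTop (𝓝 0)) {δ : ℝ≥0∞}
    (hδ : δ ≠ 0) :
    ∀ᶠ n in atTop, ∃ f, IsListDecoder (L n) f ∧ μ n {ω | X n ω ∉ f (Y n ω)} < δ := by
  filter_upwards [hε.eventually_lt_const (pos_iff_ne_zero.2 hδ)] with n hn
  simp only [listError, iInf_lt_iff] at hn
  obtain ⟨f, hf, h⟩ := hn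
  exact ⟨f, hf, h⟩

lemma eventually_exists_success [∀ n, IsProbabilityMeasure (μ n)]
    (hX : ∀ n, Measurable (X n)) (hY : ∀ n, Measurable (Y n))
    (hε : Tendsto (fun n => listError (L n) (μ n) (X n) (Y n)) atTop (𝓝 0)) {θ : ℝ}
    (hθ : 0 < θ) :
    ∀ᶠ n in atTop, ∃ f, IsListDecoder (L n) f ∧
      ENNReal.ofReal (Real.exp (-θ)) ≤ μ n {ω | X n ω ∈ f (Y n ω)} := by
  have hlt : Real.exp (-θ) < 1 := by simpa using hθ
  filter_upwards [eventually_exists_isListDecoder hε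
    (δ := ENNReal.ofReal (1 - Real.exp (-θ))) (by simpa using hθ)] with n ⟨f, hf, h⟩
  refine ⟨f, hf, ?_⟩
  have hm : MeasurableSet {ω | X n ω ∈ f (Y n ω)} :=
    (hY n).prodMk (hX n) hf.measurableSet_mem
  have hone := prob_add_prob_compl (μ := μ n) hm
  have hsum : ENNReal.ofReal (Real.exp (-θ)) + ENNReal.ofReal (1 - Real.exp (-θ)) = 1 := by
    rw [← ENNReal.ofReal_add (Real.exp_pos _).le (by linarith)]
    simp
  rw [← ENNReal.add_le_add_iff_right (ENNReal.ofReal_ne_top (r := 1 - Real.exp (-θ))), hsum,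
    ← hone]
  gcongr
  exact h.le

lemma eventually_condShannonEntropy_le [∀ n, IsProbabilityMeasure (μ n)]
    (hX : ∀ n, Measurable (X n)) (hY : ∀ n, Measurable (Y n))
    (hL : ∀ n, 1 ≤ L n) (hU : UnifIntegrableSurprisal μ X)
    (hε : Tendsto (fun n => listError (L n) (μ n) (X n) (Y n)) atTop (𝓝 0)) {η : ℝ}
    (hη : 0 < η) :
    ∀ᶠ n in atTop,
      (condShannonEntropy (μ n) (X n) (Y n) : EReal) ≤ ((Real.log (L n) + η : ℝ) : EReal) := by
  have hη3 : 0 < η / 3 := by positivity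
  have hη3' : ENNReal.ofReal (η / 3) ≠ 0 := by simpa using hη
  set B := ENNReal.ofReal (-Real.log (1 - Real.exp (-(η / 3)))) with hB
  obtain ⟨δ, hδ, hev⟩ := hU _ hη3'
  -- The first bound on the error probability serves uniform integrability, the second the constant
  -- `B`; each costs `η / 3`.
  have hδ' : min δ (ENNReal.ofReal (η / 3) / B) ≠ 0 :=
    (lt_min (pos_iff_ne_zero.2 hδ) (ENNReal.div_pos hη3' ENNReal.ofReal_ne_top)).ne'
  filter_upwards [hev, eventually_exists_isListDecoder hε hδ'] with n hn ⟨f, hf, hfe⟩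
  have hlog : 0 ≤ Real.log (L n) := Real.log_natCast_nonneg _
  have hE : MeasurableSet {ω | X n ω ∉ f (Y n ω)} :=
    ((hY n).prodMk (hX n) hf.measurableSet_mem).compl
  have h : condShannonEntropy (μ n) (X n) (Y n) ≤ ENNReal.ofReal (Real.log (L n) + η) :=
    calc condShannonEntropy (μ n) (X n) (Y n)
        ≤ ENNReal.ofReal (Real.log (L n) + η / 3) + B * μ n {ω | X n ω ∉ f (Y n ω)} +
          ∫⁻ ω in {ω | X n ω ∉ f (Y n ω)}, surprisal (law (μ n) (X n) (X n ω)) ∂μ n :=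
          condShannonEntropy_le (μ n) (hX n) (hY n) (hL n) hf hη3
      _ ≤ ENNReal.ofReal (Real.log (L n) + η / 3) + B * (ENNReal.ofReal (η / 3) / B) +
          ENNReal.ofReal (η / 3) := by
          gcongr
          · exact hfe.le.trans (min_le_right _ _)
          · exact hn _ hE (hfe.le.trans (min_le_left _ _))
      _ ≤ ENNReal.ofReal (Real.log (L n) + η / 3) + ENNReal.ofReal (η / 3) +
          ENNReal.ofReal (η / 3) := by
          gcongr
          exact ENNReal.mul_div_le
      _ = ENNReal.ofReal (Real.log (L n) + η) := by
          rw [← ENNReal.ofReal_add (by positivity) (by positivity),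
            ← ENNReal.ofReal_add (by positivity) (by positivity)]
          congr 1
          ring
  refine (EReal.coe_ennreal_le_coe_ennreal_iff.2 h).trans (le_of_eq ?_)
  rw [EReal.coe_ennreal_ofReal, max_eq_left (by positivity)]

end Limit

end FanoList

end

/-! ### The theorem -/

open FanoList in
theorem theorem4
    {Ω : ℕ → Type*} [∀ n, MeasurableSpace (Ω n)]
    (μ : ∀ n, Measure (Ω n)) [∀ n, IsProbabilityMeasure (μ n)]
    {𝓨 : ℕ → Type*} [∀ n, MeasurableSpace (𝓨 n)]
    (X : ∀ n, Ω n → ℕ) (hX : ∀ n, Measurable (X n))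
    (Y : ∀ n, Ω n → 𝓨 n) (hY : ∀ n, Measurable (Y n))
    {Ω' : Type*} [MeasurableSpace Ω'] (ν : Measure Ω') [IsProbabilityMeasure ν]
    (Z : Ω' → ℕ) (hZ : Measurable Z) (hHZ : shannonEntropy (law ν Z) < ∞)
    (L : ℕ → ℕ) (hL : ∀ n, 1 ≤ L n)
    (α : ℝ) (hα : 1 ≤ α)
    (hcond :
      1 < α ∨
      (AEP μ X ∧ ∃ C : ℝ≥0, ∀ᶠ n in atTop, shannonEntropy (law (μ n) (X n)) ≤ C) ∨
      (∃ n₀ : ℕ, ∀ n ≥ n₀, Majorizes (law (μ n) (X n)) (law ν Z)) ∨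
      (TendstoInDistribution X atTop Z μ ν ∧
        Tendsto (fun n => shannonEntropy (law (μ n) (X n))) atTop
          (𝓝 (shannonEntropy (law ν Z))))) :
    Tendsto (fun n => listError (L n) (μ n) (X n) (Y n)) atTop (𝓝 0) →
      Tendsto (fun n => max 0
        (arimotoEntropy α (μ n) (X n) (Y n) - ((Real.log (L n) : ℝ) : EReal))) atTop (𝓝 0) ∧
      Tendsto (fun n => max 0
        (hayashiEntropy α (μ n) (X n) (Y n) - ((Real.log (L n) : ℝ) : EReal))) atTop (𝓝 0) := by
  intro hε
  rcases hα.eq_or_lt with rfl | hα1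
  · have hU : UnifIntegrableSurprisal μ X := by
      rcases hcond with h | ⟨haep, C, hC⟩ | ⟨n₀, hmaj⟩ | ⟨hdist, hent⟩
      · exact absurd h (lt_irrefl _)
      · exact unifIntegrableSurprisal_of_aep hX haep hC
      · exact unifIntegrableSurprisal_of_majorizes hX (tsum_law ν hZ) hHZ.ne
          ((eventually_ge_atTop n₀).mono hmaj)
      · exact unifIntegrableSurprisal_of_tendsto hX (law_le_one ν Z) hHZ.ne
          (tendsto_law_of_tendstoInDistribution hX hZ hdist) hent
    have h := tendsto_max_zero_sub (fun η hη =>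
      eventually_condShannonEntropy_le hX hY hL hU hε (η := η) hη)
    simp only [arimotoEntropy, hayashiEntropy, if_true]
    exact ⟨h, h⟩
  · have hθ : ∀ η : ℝ, 0 < η → 0 < η * (α - 1) / α := fun η hη =>
      div_pos (mul_pos hη (by linarith)) (by linarith)
    refine ⟨tendsto_max_zero_sub fun η hη => ?_, tendsto_max_zero_sub fun η hη => ?_⟩
    · filter_upwards [eventually_exists_success hX hY hε (hθ η hη)] with n ⟨f, hf, h⟩
      exact arimotoEntropy_le (μ n) hα1 (hX n) (hY n) (hL n) hf h
    · filter_upwards [eventually_exists_success hX hY hε (hθ η hη)] with n ⟨f, hf, h⟩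
      exact hayashiEntropy_le (μ n) hα1 (hX n) (hY n) (hL n) hf h
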